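/- Let $S$ be a finite set of particles, particle $i$ having a finite-dimensional Hilbert space $\mathbb C^{d_i}$. For each unordered pair $\{i,j\}$ of distinct particles and each time $t$ let $H_{ij}(t)$ be a Hermitian operator on particles $i,j$, and let $H(t)=\sum_{\{i,j\}}H_{ij}(t)$ (each $H_{ij}$ tensored with the identity on the other particles). Let $\rho(t)$, $t\in\mathbb R$, be density operators of $S$ with $\frac{d\rho}{dt}=-i[H(t),\rho(t)]$ ($\hbar=1$; e.g. $\rho(t)=e^{-iHt}\rho(0)e^{iHt}$ for constant $H$). Let $a,b\in S$ be qubits ($d_a=d_b=2$), and let $|\phi\rangle=(|01\rangle-|10\rangle)/\sqrt2$ be their singlet state. For disjoint $X\ni a$, $Y\ni b$ in $S$, with $\rho_{XY}$ the reduced state of $X\cup Y$, the generalized singlet fraction is $$F(\rho_{XY})=\max_{U_X,U_Y}\langle\phi|\,\mathrm{tr}_{/ab}\big((U_X\otimes U_Y)\,\rho_{XY}\,(U_X\otimes U_Y)^\dagger\big)|\phi\rangle ,$$ where $U_X,U_Y$ range over the unitaries on $X$ and on $Y$, and $\mathrm{tr}_{/ab}$ is the partial trace over all particles other than $a,b$.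 Let $A\ni a$ and $B\ni b$ be disjoint subsets of $S$, and fix a time $t$; every quantity below is taken at this time. Let $A'$ consist of $A$ and all particles $i$ with $H_{ij}(t)\neq0$ for some $j\in A$, and define $B'$ likewise from $B$. Let $\partial$ be the set of unordered pairs $\{i,j\}$ that cross the boundary of $A$ or of $B$ (one particle in $A$ and the other not in $A$, or one in $B$ and the other not in $B$), and let $\|H\|=\sum_{\{i,j\}\in\partial}\|H_{ij}(t)\|_{HS}$, each pair being counted once, with the Hilbert–Schmidt norm. Then $s\mapsto F(\rho_{AB}(s))$ has a left derivative $\dot F^-$ and a right derivative $\dot F^+$ at $t$, with $\dot F^-\le\dot F^+$, and (so that the same bounds hold for $\dot F$ wherever $F$ is differentiable): 1. if $A'\cap B'=\emptyset$, then $\dot F^+\le 2\|H\|\sqrt{F(\rho_{AB})}\sqrt{F(\rho_{A'B'})-F(\rho_{AB})}$; 2. if $A'\cap B'\ne\emptyset$, then $\dot F^+\le 2\|H\|\sqrt{F(\rho_{AB})}\sqrt{1-F(\rho_{AB})}$; 3. (per-pathway version) in all cases $$\dot F^+\le 2\sum_{e\in\partial}\|H_e(t)\|_{HS}\sqrt{F(\rho_{AB})}\sqrt{F_e-F(\rho_{AB})},$$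 where for $e=\{i,j\}\in\partial$ we put $A'_e=A\cup e$ if $e$ meets $A$ and $A'_e=A$ otherwise, $B'_e=B\cup e$ if $e$ meets $B$ and $B'_e=B$ otherwise, and $F_e=F(\rho_{A'_eB'_e})$ if $A'_e\cap B'_e=\emptyset$, $F_e=1$ otherwise. -/

import Mathlib

open scoped Matrix ComplexOrder

noncomputable section

/-- Labels of the product basis of the particles in `S`, where particle `i` has Hilbert space
`ℂ ^ d i`; the Hilbert space of `S` is `Conf d S → ℂ`. -/
abbrev Conf {ι : Type*} (d : ι → ℕ) (S : Finset ι) : Type _ := (i : {i // i ∈ S}) → Fin (d i)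

/-- Operators on the Hilbert space of the particles in `S`. -/
abbrev Op {ι : Type*} (d : ι → ℕ) (S : Finset ι) : Type _ := Matrix (Conf d S) (Conf d S) ℂ

/-- Restriction of a basis label to a subset of the particles. -/
def res {ι : Type*} {d : ι → ℕ} {S T : Finset ι} (h : T ⊆ S) (x : Conf d S) : Conf d T :=
  fun i => x ⟨i.1, h i.2⟩

/-- `M ⊗ 1` for an operator `M` on the particles in `T ⊆ S`: it acts as the identity on `S \ T`. -/
def extendOp {ι : Type*} [DecidableEq ι] {d : ι → ℕ} {S T : Finset ι} (h : T ⊆ S) (M : Op d T) :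
    Op d S :=
  Matrix.of fun x y =>
    if ∀ i : {i // i ∈ S}, i.1 ∉ T → x i = y i then M (res h x) (res h y) else 0

/-- Partial trace over all particles of `S` that are not in `T`. -/
def partialTrace {ι : Type*} [DecidableEq ι] {d : ι → ℕ} {S T : Finset ι} (h : T ⊆ S)
    (M : Op d S) : Op d T :=
  Matrix.of fun x y =>
    ∑ u : Conf d S, ∑ v : Conf d S,
      if res h u = x ∧ res h v = y ∧ ∀ i : {i // i ∈ S}, i.1 ∉ T → u i = v i then M u v else 0

/-- The tensor product `U ⊗ V` of operators on disjoint sets of particles `A` and `B`. -/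
def tensorOp {ι : Type*} [DecidableEq ι] {d : ι → ℕ} {A B : Finset ι} (U : Op d A) (V : Op d B) :
    Op d (A ∪ B) :=
  Matrix.of fun x y =>
    U (res Finset.subset_union_left x) (res Finset.subset_union_left y) *
      V (res Finset.subset_union_right x) (res Finset.subset_union_right y)

/-- The Hilbert–Schmidt norm `√(tr (Mᴴ M))`. -/
def hsNorm {ι : Type*} [DecidableEq ι] {d : ι → ℕ} {S : Finset ι} (M : Op d S) : ℝ :=
  Real.sqrt (∑ x, ∑ y, ‖M x y‖ ^ 2)

/-- Density operators: positive semidefinite of trace one. -/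
def IsDensity {ι : Type*} [DecidableEq ι] {d : ι → ℕ} {S : Finset ι} (ρ : Op d S) : Prop :=
  ρ.PosSemidef ∧ ρ.trace = 1

/-- The singlet `(|01⟩ - |10⟩) / √2` of the qubits `a` and `b`. -/
def singlet {ι : Type*} [DecidableEq ι] (d : ι → ℕ) (a b : ι) : Conf d {a, b} → ℂ := fun x =>
  let xa : ℕ := x ⟨a, by simp⟩
  let xb : ℕ := x ⟨b, by simp⟩
  if xa = 0 ∧ xb = 1 then ((Real.sqrt 2 : ℝ) : ℂ)⁻¹
  else if xa = 1 ∧ xb = 0 then -((Real.sqrt 2 : ℝ) : ℂ)⁻¹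
  else 0

theorem pair_subset_union {ι : Type*} [DecidableEq ι] {a b : ι} {A B : Finset ι}
    (ha : a ∈ A) (hb : b ∈ B) : ({a, b} : Finset ι) ⊆ A ∪ B := by
  intro i hi
  rcases Finset.mem_insert.1 hi with rfl | hi
  · exact Finset.mem_union_left _ ha
  · exact Finset.mem_union_right _ (Finset.mem_singleton.1 hi ▸ hb)

/-- The generalized singlet fraction of a state `ρAB` of the disjoint sets `A ∋ a`, `B ∋ b`: the
maximum over unitaries `U` on `A` and `V` on `B` of
`⟨φ| tr_{/ab} ((U ⊗ V) ρAB (U ⊗ V)ᴴ) |φ⟩`, with `φ` the singlet of `a` and `b`.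
(The supremum is attained, since the unitary groups are compact.) -/
def singletFraction {ι : Type*} [DecidableEq ι] {d : ι → ℕ} {a b : ι} {A B : Finset ι}
    (ha : a ∈ A) (hb : b ∈ B) (ρAB : Op d (A ∪ B)) : ℝ :=
  ⨆ W : Matrix.unitaryGroup (Conf d A) ℂ × Matrix.unitaryGroup (Conf d B) ℂ,
    (star (singlet d a b) ⬝ᵥ
      (partialTrace (pair_subset_union ha hb)
          (tensorOp (W.1 : Op d A) (W.2 : Op d B) * ρAB *
            (tensorOp (W.1 : Op d A) (W.2 : Op d B))ᴴ) *ᵥ singlet d a b)).re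

/-- Unordered pairs of distinct particles. -/
abbrev Pair (ι : Type*) : Type _ := {e : Finset ι // e.card = 2}

/-- A network of two-body interactions: for each pair `e = {i, j}` a Hermitian operator
`H_ij` on the two particles (zero if they do not interact). -/
structure Network {ι : Type*} (d : ι → ℕ) where
  term : (e : Pair ι) → Op d e.1
  isHermitian : ∀ e, (term e).IsHermitian

namespace Network

variable {ι : Type*} [Fintype ι] [DecidableEq ι] {d : ι → ℕ}

/-- The total Hamiltonian, the sum of the `H_ij` over all pairs `{i, j}`. -/
def hamiltonian (H : Network d) : Op d Finset.univ :=
  ∑ e : Pair ι, extendOp (Finset.subset_univ e.1) (H.term e)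

open Classical in
/-- The one-step neighbourhood `A'`: all particles of `A`, and all particles that are connected by
a (nonzero) interaction to a particle of `A`. -/
def nbhd (H : Network d) (A : Finset ι) : Finset ι :=
  Finset.univ.filter fun i =>
    i ∈ A ∨ ∃ e : Pair ι, H.term e ≠ 0 ∧ i ∈ e.1 ∧ ∃ j ∈ A, j ∈ e.1

theorem subset_nbhd (H : Network d) (A : Finset ι) : A ⊆ H.nbhd A := by
  intro i hi
  simp [nbhd, hi]

end Network

/-- The pair `e` connects a particle in `A` to one outside `A`. -/
def Crosses {ι : Type*} (e : Pair ι) (A : Finset ι) : Prop :=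
  (∃ i ∈ e.1, i ∈ A) ∧ ∃ j ∈ e.1, j ∉ A

open Classical in
/-- The pairs that cross the boundary of `A` or the boundary of `B`. -/
def boundary {ι : Type*} [Fintype ι] (A B : Finset ι) : Finset (Pair ι) :=
  Finset.univ.filter fun e => Crosses e A ∨ Crosses e B

/-- `‖H‖`: the sum of the Hilbert–Schmidt norms of the interactions that cross the boundary of `A`
or of `B`, each counted once. -/
def Network.boundaryNorm {ι : Type*} [Fintype ι] [DecidableEq ι] {d : ι → ℕ} (H : Network d)
    (A B : Finset ι) : ℝ :=
  ∑ e ∈ boundary A B, hsNorm (H.term e)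

/-- `A` enlarged by the pair `e` if `e` contains a particle of `A`, and `A` otherwise. -/
def enlarge {ι : Type*} [DecidableEq ι] (A : Finset ι) (e : Pair ι) : Finset ι :=
  if ∃ i ∈ e.1, i ∈ A then A ∪ e.1 else A

theorem subset_enlarge {ι : Type*} [DecidableEq ι] (A : Finset ι) (e : Pair ι) :
    A ⊆ enlarge A e := by
  unfold enlarge
  split_ifs
  · exact Finset.subset_union_left
  · exact Finset.Subset.refl A

/-- The generalized singlet fraction of the reduced state `ρ_AB` of a state `ρ` of all particles. -/
def reducedFraction {ι : Type*} [Fintype ι] [DecidableEq ι] {d : ι → ℕ} {a b : ι} {A B : Finset ι}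
    (ha : a ∈ A) (hb : b ∈ B) (ρ : Op d Finset.univ) : ℝ :=
  singletFraction ha hb (partialTrace (Finset.subset_univ (A ∪ B)) ρ)

/-- The generalized singlet fraction for the sets `A`, `B` enlarged along the interaction `e`, with
the value `1` if the enlarged sets overlap. -/
def pathFraction {ι : Type*} [Fintype ι] [DecidableEq ι] {d : ι → ℕ} {a b : ι} {A B : Finset ι}
    (ha : a ∈ A) (hb : b ∈ B) (e : Pair ι) (ρ : Op d Finset.univ) : ℝ :=
  if Disjoint (enlarge A e) (enlarge B e) then
    reducedFraction (subset_enlarge A e ha) (subset_enlarge B e hb) ρ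
  else 1

/-- `ρ` is a trajectory of states that evolves under the (possibly time-dependent) network
Hamiltonian: `dρ/dt = -i [H(t), ρ(t)]`, entry by entry, in units with `ħ = 1`. -/
structure IsEvolution {ι : Type*} [Fintype ι] [DecidableEq ι] {d : ι → ℕ} (H : ℝ → Network d)
    (ρ : ℝ → Op d Finset.univ) : Prop where
  isDensity : ∀ t, IsDensity (ρ t)
  vonNeumann : ∀ t x y, HasDerivAt (fun s => ρ s x y)
    ((-Complex.I • ((H t).hamiltonian * ρ t - ρ t * (H t).hamiltonian)) x y) t

end

/-! ### One-sided derivatives of a maximum of linear functionals -/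

/-! The fraction is the maximum of tr(ρP) over the singlet projections P rotated by local unitaries,
a compact family of functionals linear in ρ. Along the tangent line of ρ at t this maximum is
convex. Hence the one-sided derivatives exist and are ordered, and the right one is at most tr(ρ̇P)
for some P that is optimal at t (`exists_oneSided_deriv_iSup_clm`, a form of Danskin's theorem).

For this P, tr(ρ̇P) is the sum over pairs e of -i tr([H_e, ρ]P), which is real-linear in H_e.
Diagonalizing H_e, whose eigenvalues are at most ‖H_e‖_HS in modulus, reduces the estimate to
reflections K = K†, K² = 1 (`linear_le_of_reflection_le`). If c² + s² = 1, then c + isK is a unitary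
on e, which the local unitaries of the enlarged sets A'_e, B'_e absorb. So the expectation of P
conjugated by it, a quadratic form in (c, s), lies between 0 and F_e on the unit circle, and it
equals F at (1, 0). Such a form has off-diagonal entry at most √(F(F_e - F)) in modulus
(`sq_le_mul_of_quadratic_le`), and K contributes twice this entry up to sign.

A pair off the boundary has F_e = F and drops out. This is the per-pathway bound; the other two
follow from F_e ≤ F(ρ_{A'B'}) for interacting pairs, or from F_e ≤ 1. -/

theorem iSup_eq_of_forall_le {K : Type*} {f : K → ℝ} {w : K} (hw : ∀ w', f w' ≤ f w) :
    ⨆ w', f w' = f w :=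
  haveI : Nonempty K := ⟨w⟩
  le_antisymm (ciSup_le hw) (le_ciSup ⟨f w, Set.forall_mem_range.2 hw⟩ w)

section Danskin

open Filter Topology

variable {K E : Type*} [TopologicalSpace K] [CompactSpace K]
  [NormedAddCommGroup E] [NormedSpace ℝ E] {L : K → E →L[ℝ] ℝ}

theorem bddAbove_range_clm (hL : Continuous L) (x : E) : BddAbove (Set.range fun w => L w x) :=
  (isCompact_range (hL.clm_apply continuous_const)).bddAbove

theorem exists_forall_clm_le [Nonempty K] (hL : Continuous L) (x : E) : ∃ w, ∀ w', L w' x ≤ L w x := by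
  obtain ⟨w, -, hw⟩ := isCompact_univ.exists_isMaxOn Set.univ_nonempty
    (hL.clm_apply (continuous_const (y := x))).continuousOn
  exact ⟨w, fun w' => hw (Set.mem_univ w')⟩

/-- Compactness bounds the operator norms uniformly. The Lipschitz estimate is what allows a curve
to be replaced by its tangent line. -/
theorem exists_abs_iSup_clm_sub_le [Nonempty K] (hL : Continuous L) :
    ∃ C, ∀ x y : E, |(⨆ w, L w x) - ⨆ w, L w y| ≤ C * ‖x - y‖ := by
  obtain ⟨C, hC⟩ := (isCompact_range hL.norm).bddAbove
  have key : ∀ x y : E, (⨆ w, L w x) ≤ (⨆ w, L w y) + C * ‖x - y‖ := fun x y =>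
    ciSup_le fun w => by
      have h1 : L w x = L w y + L w (x - y) := by simp
      have h2 : L w (x - y) ≤ C * ‖x - y‖ :=
        (le_abs_self _).trans (((L w).le_opNorm _).trans
          (mul_le_mul_of_nonneg_right (hC ⟨w, rfl⟩) (norm_nonneg _)))
      have h3 := le_ciSup (bddAbove_range_clm hL y) w
      linarith
  refine ⟨C, fun x y => abs_le.2 ⟨?_, ?_⟩⟩
  · have := key y x
    rw [norm_sub_rev] at this
    linarith
  · linarith [key x y]

theorem convexOn_iSup_clm_line [Nonempty K] (hL : Continuous L) (x v : E) (t : ℝ) :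
    ConvexOn ℝ Set.univ fun s : ℝ => ⨆ w, L w (x + (s - t) • v) := by
  refine ⟨convex_univ, fun p _ q _ α β hα hβ hαβ => ciSup_le fun w => ?_⟩
  have h : L w (x + ((α • p + β • q) - t) • v) =
      α * L w (x + (p - t) • v) + β * L w (x + (q - t) • v) := by
    simp only [map_add, map_smul, smul_eq_mul]
    have : β = 1 - α := by linarith
    subst this
    ring
  rw [h, smul_eq_mul, smul_eq_mul]
  exact add_le_add
    (mul_le_mul_of_nonneg_left (le_ciSup (bddAbove_range_clm hL (x + (p - t) • v)) w) hα)
    (mul_le_mul_of_nonneg_left (le_ciSup (bddAbove_range_clm hL (x + (q - t) • v)) w) hβ)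

theorem tendsto_clm_apply {α : Type*} {l : Filter α} {f : α → E →L[ℝ] ℝ} {g : α → E}
    {f₀ : E →L[ℝ] ℝ} {x : E} (hf : Tendsto f l (𝓝 f₀)) (hg : Tendsto g l (𝓝 x)) :
    Tendsto (fun a => f a (g a)) l (𝓝 (f₀ x)) :=
  ((isBoundedBilinearMap_apply (𝕜 := ℝ)).continuous.tendsto (f₀, x)).comp (hf.prodMk_nhds hg)

/-- The right derivative of a maximum of linear functionals along a line is attained at one of the
maximizing functionals. -/
theorem exists_maximizer_rightDeriv_le [Nonempty K] (hL : Continuous L) {x v : E} {t r : ℝ}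
    (hr : HasDerivWithinAt (fun s : ℝ => ⨆ w, L w (x + (s - t) • v)) r (Set.Ioi t) t) :
    ∃ w, (∀ w', L w' x ≤ L w x) ∧ r ≤ L w v := by
  choose m hm using fun s : ℝ => exists_forall_clm_le hL (x + (s - t) • v)
  -- Along an ultrafilter finer than `𝓝[>] t` the chosen maximizers converge by compactness of `K`
  -- alone; no countability is needed to extract a limit.
  set 𝒰 : Ultrafilter ℝ := Ultrafilter.of (𝓝[>] t)
  have h𝒰 : (𝒰 : Filter ℝ) ≤ 𝓝[>] t := Ultrafilter.of_le _
  obtain ⟨w, hw⟩ : ∃ w, Tendsto m 𝒰 (𝓝 w) := by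
    obtain ⟨w, -, hw⟩ := isCompact_univ.ultrafilter_le_nhds (𝒰.map m) (by simp)
    exact ⟨w, hw⟩
  have hLw : Tendsto (fun s => L (m s)) 𝒰 (𝓝 (L w)) := (hL.tendsto w).comp hw
  have hline : Tendsto (fun s : ℝ => x + (s - t) • v) 𝒰 (𝓝 x) := by
    have : Tendsto (fun s : ℝ => x + (s - t) • v) (𝓝 t) (𝓝 (x + (t - t) • v)) :=
      Continuous.tendsto (by fun_prop) t
    rw [sub_self, zero_smul, add_zero] at this
    exact this.mono_left (h𝒰.trans nhdsWithin_le_nhds)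
  refine ⟨w, fun w' => ?_, ?_⟩
  · exact le_of_tendsto_of_tendsto (((L w').continuous.tendsto x).comp hline)
      (tendsto_clm_apply hLw hline) (Eventually.of_forall fun s => hm s w')
  · rw [hasDerivWithinAt_iff_tendsto_slope' (by simp)] at hr
    refine le_of_tendsto_of_tendsto (hr.mono_left h𝒰)
      (tendsto_clm_apply hLw tendsto_const_nhds) ?_
    filter_upwards [h𝒰 self_mem_nhdsWithin] with s hs
    have hs' : 0 < s - t := sub_pos.2 hs
    -- `m s` is optimal at `s` but only a competitor at `t`, so the slope of the maximum is at most
    -- that of the single functional `L (m s)`.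
    rw [slope_def_field, div_le_iff₀ hs', iSup_eq_of_forall_le (hm s), sub_self, zero_smul, add_zero]
    have := le_ciSup (bddAbove_range_clm hL x) (m s)
    simp only [map_add, map_smul, smul_eq_mul] at this ⊢
    linarith

/-- The maximum along `γ` differs from the maximum along the tangent line by o(s - t), and the
latter is convex in `s`. -/
theorem exists_oneSided_deriv_iSup_clm [Nonempty K] (hL : Continuous L) {γ : ℝ → E} {v : E} {t : ℝ}
    (hγ : HasDerivAt γ v t) :
    ∃ l r : ℝ, HasDerivWithinAt (fun s => ⨆ w, L w (γ s)) l (Set.Iic t) t ∧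
      HasDerivWithinAt (fun s => ⨆ w, L w (γ s)) r (Set.Ici t) t ∧ l ≤ r ∧
      ∃ w, (∀ w', L w' (γ t) ≤ L w (γ t)) ∧ r ≤ L w v := by
  set G : ℝ → ℝ := fun s => ⨆ w, L w (γ t + (s - t) • v) with hG
  have hconv : ConvexOn ℝ Set.univ G := convexOn_iSup_clm_line hL _ _ _
  have hint : t ∈ interior (Set.univ : Set ℝ) := by simp
  have hr := hconv.hasDerivWithinAt_rightDeriv_of_mem_interior hint
  have hl := hconv.hasDerivWithinAt_leftDeriv_of_mem_interior hint
  have hlr := hconv.leftDeriv_le_rightDeriv_of_mem_interior hint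
  have hdiff : HasDerivAt (fun s => (⨆ w, L w (γ s)) - G s) 0 t := by
    obtain ⟨C, hC⟩ := exists_abs_iSup_clm_sub_le hL
    rw [hasDerivAt_iff_isLittleO] at hγ ⊢
    refine Asymptotics.IsBigO.trans_isLittleO (Asymptotics.IsBigO.of_bound C ?_) hγ
    refine Eventually.of_forall fun s => ?_
    simpa [hG, sub_sub] using hC (γ s) (γ t + (s - t) • v)
  have hsum : ∀ {c : ℝ} {S : Set ℝ}, HasDerivWithinAt G c S t →
      HasDerivWithinAt (fun s => ⨆ w, L w (γ s)) c S t := fun {c S} h => by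
    have e : (fun s => ⨆ w, L w (γ s)) = (fun s => (⨆ w, L w (γ s)) - G s) + G := by
      ext s
      simp
    rw [e, ← zero_add c]
    exact hdiff.hasDerivWithinAt.add h
  exact ⟨_, _, hsum hl.Iic_of_Iio, hsum hr.Ici_of_Ioi, hlr, exists_maximizer_rightDeriv_le hL hr⟩

end Danskin

/-! ### Commutators and reflections -/

/-- Both the form and `M` minus the form are positive semidefinite, so γ² ≤ αβ and γ² ≤ (M - α)(M -
β). Weighting these by M - α and α and adding eliminates β and leaves Mγ² ≤ Mα(M - α). -/
theorem sq_le_mul_of_quadratic_le {α β γ M : ℝ}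
    (h0 : ∀ c s : ℝ, 0 ≤ c ^ 2 * α + s ^ 2 * β + c * s * (2 * γ))
    (h1 : ∀ c s : ℝ, c ^ 2 + s ^ 2 = 1 → c ^ 2 * α + s ^ 2 * β + c * s * (2 * γ) ≤ M) :
    γ ^ 2 ≤ α * (M - α) := by
  have h1' : ∀ c s : ℝ, c ^ 2 * α + s ^ 2 * β + c * s * (2 * γ) ≤ M * (c ^ 2 + s ^ 2) := by
    intro c s
    rcases (add_nonneg (sq_nonneg c) (sq_nonneg s)).eq_or_lt with h | h
    · have hc : c = 0 := by nlinarith [sq_nonneg c, sq_nonneg s]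
      have hs : s = 0 := by nlinarith [sq_nonneg c, sq_nonneg s]
      simp [hc, hs]
    · have hq : Real.sqrt (c ^ 2 + s ^ 2) ^ 2 = c ^ 2 + s ^ 2 := Real.sq_sqrt h.le
      have hq0 : Real.sqrt (c ^ 2 + s ^ 2) ≠ 0 := (Real.sqrt_pos.2 h).ne'
      have := h1 (c / Real.sqrt (c ^ 2 + s ^ 2)) (s / Real.sqrt (c ^ 2 + s ^ 2)) (by
        rw [div_pow, div_pow, hq]; field_simp)
      have e : (c / Real.sqrt (c ^ 2 + s ^ 2)) ^ 2 * α + (s / Real.sqrt (c ^ 2 + s ^ 2)) ^ 2 * β +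
          c / Real.sqrt (c ^ 2 + s ^ 2) * (s / Real.sqrt (c ^ 2 + s ^ 2)) * (2 * γ) =
          (c ^ 2 * α + s ^ 2 * β + c * s * (2 * γ)) / Real.sqrt (c ^ 2 + s ^ 2) ^ 2 := by
        field_simp
      rwa [e, hq, div_le_iff₀ h] at this
  have hα : 0 ≤ α := by simpa using h0 1 0
  have hMα : 0 ≤ M - α := by simpa using h1' 1 0
  have d1 := discrim_le_zero (a := β) (b := 2 * γ) (c := α) fun s => by linarith [h0 1 s]
  have d2 := discrim_le_zero (a := M - β) (b := -(2 * γ)) (c := M - α) fun s => by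
    linarith [h1' 1 s]
  rw [discrim] at d1 d2
  -- The factor M cannot be cancelled when M = 0; then α = 0 and the first discriminant already
  -- forces γ = 0.
  rcases (add_nonneg hα hMα).eq_or_lt with h | h
  · have : α = 0 := by linarith
    subst this
    nlinarith
  · have e1 := mul_le_mul_of_nonneg_left (by linarith : γ ^ 2 ≤ β * α) hMα
    have e2 := mul_le_mul_of_nonneg_left (by linarith : γ ^ 2 ≤ (M - β) * (M - α)) hα
    refine le_of_mul_le_mul_left ?_ h
    nlinarith

section Commutator

variable {m n : Type*} [Fintype m] [DecidableEq m] [Fintype n] [DecidableEq n]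

open scoped MatrixOrder in
theorem re_trace_mul_nonneg {ρ X : Matrix n n ℂ} (hρ : ρ.PosSemidef) (hX : X.PosSemidef) :
    0 ≤ (ρ * X).trace.re := by
  obtain ⟨B, rfl⟩ := CStarAlgebra.nonneg_iff_eq_star_mul_self.1 hX.nonneg
  rw [← Matrix.mul_assoc, Matrix.trace_mul_comm, ← Matrix.mul_assoc]
  exact (Complex.le_def.1 (hρ.mul_mul_conjTranspose_same B).trace_nonneg).1

/-- If `k` is a reflection and no rotation `c + i s k` raises the expectation of `P` above `M`,
then the rate of change of the expectation of `P` under the Hamiltonian `k` is bounded. -/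
theorem abs_commutator_le_of_reflection {ρ P k : Matrix n n ℂ} (hρ : ρ.PosSemidef)
    (hP : P.PosSemidef) (hk : kᴴ = k) {M : ℝ}
    (hM : ∀ c s : ℝ, c ^ 2 + s ^ 2 = 1 →
      (ρ * (((c : ℂ) • 1 + (s * Complex.I) • k)ᴴ * P * ((c : ℂ) • 1 + (s * Complex.I) • k))).trace.re
        ≤ M) :
    |((-Complex.I • (k * ρ - ρ * k)) * P).trace.re| ≤
      2 * (Real.sqrt (ρ * P).trace.re * Real.sqrt (M - (ρ * P).trace.re)) := by
  set g := ((-Complex.I • (k * ρ - ρ * k)) * P).trace.re with hg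
  -- The cross term of the conjugated expectation is the commutator: the off-diagonal entry is -g/2,
  -- which is the source of the factor 2 in the bound.
  have expand : ∀ c s : ℝ,
      (ρ * (((c : ℂ) • 1 + (s * Complex.I) • k)ᴴ * P * ((c : ℂ) • 1 + (s * Complex.I) • k))).trace.re
        = c ^ 2 * (ρ * P).trace.re + s ^ 2 * (ρ * (k * P * k)).trace.re + c * s * (2 * (-g / 2)) := by
    intro c s
    have e1 : (ρ * (((c : ℂ) • 1 + (s * Complex.I) • k)ᴴ * P * ((c : ℂ) • 1 + (s * Complex.I) • k)))
        = ((c ^ 2 : ℝ) : ℂ) • (ρ * P) + ((s ^ 2 : ℝ) : ℂ) • (ρ * (k * P * k)) +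
          ((c * s : ℝ) : ℂ) • (Complex.I • (ρ * P * k) - Complex.I • (ρ * k * P)) := by
      simp only [Matrix.conjTranspose_add, Matrix.conjTranspose_smul, hk,
        Matrix.conjTranspose_one, Matrix.add_mul, Matrix.mul_add, Matrix.smul_mul, Matrix.mul_smul,
        Matrix.one_mul, Matrix.mul_one, smul_smul, smul_sub, Matrix.mul_assoc]
      have hI : (Complex.I : ℂ) ^ 2 = -1 := Complex.I_sq
      simp only [star_mul', RCLike.star_def, Complex.conj_ofReal, Complex.conj_I, smul_add,
        smul_smul]
      have h2 : (s : ℂ) * Complex.I * (s * -Complex.I) = ((s ^ 2 : ℝ) : ℂ) := by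
        push_cast; linear_combination (-(s : ℂ) ^ 2) * hI
      rw [h2]
      push_cast
      module
    have e2 : g = -((Complex.I • (ρ * P * k) - Complex.I • (ρ * k * P)).trace.re) := by
      have : (k * ρ * P).trace = (ρ * P * k).trace := by
        rw [Matrix.mul_assoc, Matrix.trace_mul_comm]
      rw [hg, Matrix.smul_mul, Matrix.sub_mul, Matrix.trace_smul, Matrix.trace_sub, this,
        Matrix.trace_sub, Matrix.trace_smul, Matrix.trace_smul]
      simp only [smul_eq_mul, neg_mul, Complex.neg_re, Complex.I_mul_re, Complex.sub_re,
        Complex.sub_im]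
      ring
    rw [e1, e2, Matrix.trace_add, Matrix.trace_add, Matrix.trace_smul, Matrix.trace_smul,
      Matrix.trace_smul, Complex.add_re, Complex.add_re, smul_eq_mul, smul_eq_mul, smul_eq_mul,
      Complex.re_ofReal_mul, Complex.re_ofReal_mul, Complex.re_ofReal_mul]
    ring
  have hsq := sq_le_mul_of_quadratic_le (α := (ρ * P).trace.re)
    (β := (ρ * (k * P * k)).trace.re) (γ := -g / 2) (M := M)
    (fun c s => by
      rw [← expand]
      exact re_trace_mul_nonneg hρ (hP.conjTranspose_mul_mul_same _))
    (fun c s h => by rw [← expand]; exact hM c s h)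
  have h0 : 0 ≤ (ρ * P).trace.re := re_trace_mul_nonneg hρ hP
  rw [← Real.sqrt_mul h0]
  have := Real.abs_le_sqrt hsq
  rw [abs_div, abs_neg, abs_two] at this
  linarith

/-- The Hilbert–Schmidt norm is unitarily invariant, so its square is the sum of the squared
eigenvalues. -/
theorem abs_eigenvalue_le_sqrt_sum_sq {H : Matrix m m ℂ} (hH : H.IsHermitian) (k : m) :
    |hH.eigenvalues k| ≤ Real.sqrt (∑ x, ∑ y, ‖H x y‖ ^ 2) := by
  apply Real.abs_le_sqrt
  have hD := hH.conjStarAlgAut_star_eigenvectorUnitary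
  have tr : ∀ X : Matrix m m ℂ, (Xᴴ * X).trace = ((∑ x, ∑ y, ‖X x y‖ ^ 2 : ℝ) : ℂ) := by
    intro X
    rw [Matrix.trace, Finset.sum_congr rfl fun i _ => Matrix.diag_apply _ i]
    simp only [Matrix.mul_apply, Matrix.conjTranspose_apply]
    rw [Finset.sum_comm]
    push_cast
    refine Finset.sum_congr rfl fun x _ => Finset.sum_congr rfl fun y _ => ?_
    rw [RCLike.star_def, Complex.conj_mul']
  have e : (Hᴴ * H).trace = ((Matrix.diagonal (RCLike.ofReal ∘ hH.eigenvalues : m → ℂ))ᴴ *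
      Matrix.diagonal (RCLike.ofReal ∘ hH.eigenvalues : m → ℂ)).trace := by
    rw [← hD, Unitary.conjStarAlgAut_star_apply]
    set U : Matrix m m ℂ := (hH.eigenvectorUnitary : Matrix m m ℂ)
    have hU : U * star U = 1 := Unitary.coe_mul_star_self _
    rw [← Matrix.star_eq_conjTranspose (star U * H * U), star_mul, star_mul, star_star,
      ← Matrix.star_eq_conjTranspose H]
    calc (star H * H).trace = ((U * star U) * star H * (U * star U) * H).trace := by
          rw [hU, one_mul, mul_one]
      _ = (U * (star U * star H * U * star U * H)).trace := by simp only [mul_assoc]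
      _ = ((star U * star H * U * star U * H) * U).trace := Matrix.trace_mul_comm _ _
      _ = _ := by simp only [mul_assoc]
  rw [Matrix.diagonal_conjTranspose, Matrix.diagonal_mul_diagonal, Matrix.trace_diagonal, tr] at e
  have e' : (∑ x, ∑ y, ‖H x y‖ ^ 2) = ∑ i, hH.eigenvalues i ^ 2 := by
    have : ((∑ x, ∑ y, ‖H x y‖ ^ 2 : ℝ) : ℂ) = ((∑ i, hH.eigenvalues i ^ 2 : ℝ) : ℂ) := by
      rw [e]
      push_cast
      refine Finset.sum_congr rfl fun i _ => ?_
      simp [sq]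
    exact_mod_cast this
  rw [e']
  exact Finset.single_le_sum (f := fun i => hH.eigenvalues i ^ 2) (fun i _ => sq_nonneg _)
    (Finset.mem_univ k)

/-- A real-linear functional bounded by `c` on reflections is bounded by `c` times the
Hilbert–Schmidt norm on Hermitian matrices. -/
theorem linear_le_of_reflection_le (g : Matrix m m ℂ →ₗ[ℝ] ℝ) {c : ℝ}
    (hg : ∀ K : Matrix m m ℂ, Kᴴ = K → K * K = 1 → g K ≤ c) {H : Matrix m m ℂ}
    (hH : H.IsHermitian) : g H ≤ Real.sqrt (∑ x, ∑ y, ‖H x y‖ ^ 2) * c := by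
  set N := Real.sqrt (∑ x, ∑ y, ‖H x y‖ ^ 2)
  set U : Matrix m m ℂ := (hH.eigenvectorUnitary : Matrix m m ℂ) with hU
  have hUU : star U * U = 1 := Unitary.coe_star_mul_self _
  have hUU' : U * star U = 1 := Unitary.coe_mul_star_self _
  -- In the eigenbasis of `H`, held fixed, `g` becomes a functional of the real diagonal.
  let D : (m → ℝ) →ₗ[ℝ] ℝ := g ∘ₗ
    { toFun := fun f => U * Matrix.diagonal (fun i => (f i : ℂ)) * star U
      map_add' := fun f f' => by
        rw [← Matrix.add_mul, ← Matrix.mul_add, Matrix.diagonal_add]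
        simp
      map_smul' := fun r f => by
        have : Matrix.diagonal (fun i => (((r • f) i : ℝ) : ℂ)) =
            r • Matrix.diagonal (fun i => (f i : ℂ)) := by
          rw [← Matrix.diagonal_smul]
          congr 1
          ext i
          simp
        rw [this, Matrix.mul_smul, Matrix.smul_mul, RingHom.id_apply] }
  have hD : ∀ f, D f = g (U * Matrix.diagonal (fun i => (f i : ℂ)) * star U) := fun f => rfl
  have hHD : g H = D hH.eigenvalues := by
    rw [hD]
    conv_lhs => rw [hH.spectral_theorem, Unitary.conjStarAlgAut_apply]
    rfl
  have hsum : ∀ f : m → ℝ, D f = ∑ i, f i * D (Pi.single i 1) := by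
    intro f
    conv_lhs => rw [pi_eq_sum_univ' f]
    simp [map_sum]
  -- The signs that make every term of `D ε` nonnegative; the matrix with diagonal `ε` in this basis
  -- is a reflection, so ∑ |D(eᵢ)| ≤ c.
  let ε : m → ℝ := fun i => if 0 ≤ D (Pi.single i 1) then 1 else -1
  have hεε : ∀ i, ε i * ε i = 1 := fun i => by simp only [ε]; split_ifs <;> norm_num
  have hε : D ε ≤ c := by
    rw [hD]
    apply hg
    · rw [← Matrix.star_eq_conjTranspose, star_mul, star_mul, star_star,
        Matrix.star_eq_conjTranspose (Matrix.diagonal _), Matrix.diagonal_conjTranspose, mul_assoc]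
      congr 3
      ext i
      simp
    · calc U * Matrix.diagonal (fun i => (ε i : ℂ)) * star U *
            (U * Matrix.diagonal (fun i => (ε i : ℂ)) * star U)
          = U * Matrix.diagonal (fun i => (ε i : ℂ)) * (star U * U) *
            Matrix.diagonal (fun i => (ε i : ℂ)) * star U := by simp only [mul_assoc]
        _ = U * (Matrix.diagonal (fun i => (ε i : ℂ)) * Matrix.diagonal (fun i => (ε i : ℂ))) *
            star U := by rw [hUU, mul_one]; simp only [mul_assoc]
        _ = 1 := by
          rw [Matrix.diagonal_mul_diagonal]
          simp only [← Complex.ofReal_mul, hεε, Complex.ofReal_one, Matrix.diagonal_one, mul_one,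
            hUU']
  rw [hHD, hsum]
  refine le_trans ?_ (mul_le_mul_of_nonneg_left hε (Real.sqrt_nonneg _))
  rw [hsum ε, Finset.mul_sum]
  refine Finset.sum_le_sum fun i _ => ?_
  have hlam := abs_eigenvalue_le_sqrt_sum_sq hH i
  have habs : ε i * D (Pi.single i 1) = |D (Pi.single i 1)| := by
    simp only [ε]
    split_ifs with h
    · rw [one_mul, abs_of_nonneg h]
    · rw [neg_one_mul, abs_of_neg (not_le.1 h)]
  rw [habs]
  refine (le_abs_self _).trans ?_
  rw [abs_mul]
  exact mul_le_mul_of_nonneg_right hlam (abs_nonneg _)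

theorem commutator_le (j : Matrix m m ℂ →⋆ₐ[ℂ] Matrix n n ℂ) {ρ P : Matrix n n ℂ}
    (hρ : ρ.PosSemidef) (hP : P.PosSemidef) {M : ℝ}
    (hM : ∀ V ∈ Matrix.unitaryGroup m ℂ, (ρ * ((j V)ᴴ * P * j V)).trace.re ≤ M)
    {H : Matrix m m ℂ} (hH : H.IsHermitian) :
    ((-Complex.I • (j H * ρ - ρ * j H)) * P).trace.re ≤
      Real.sqrt (∑ x, ∑ y, ‖H x y‖ ^ 2) *
        (2 * (Real.sqrt (ρ * P).trace.re * Real.sqrt (M - (ρ * P).trace.re))) := by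
  let g : Matrix m m ℂ →ₗ[ℝ] ℝ :=
    { toFun := fun H => ((-Complex.I • (j H * ρ - ρ * j H)) * P).trace.re
      map_add' := fun X Y => by
        rw [← Complex.add_re, ← Matrix.trace_add, ← Matrix.add_mul, ← smul_add, map_add]
        congr 4
        noncomm_ring
      map_smul' := fun r X => by
        have : j (r • X) = (r : ℂ) • j X := by
          rw [← map_smul]
          rfl
        have e : -Complex.I • (j (r • X) * ρ - ρ * j (r • X)) * P =
            (r : ℂ) • (-Complex.I • (j X * ρ - ρ * j X) * P) := by
          simp only [this, Matrix.smul_mul, Matrix.mul_smul, Matrix.sub_mul]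
          module
        rw [e, Matrix.trace_smul, smul_eq_mul, Complex.re_ofReal_mul]
        rfl }
  refine linear_le_of_reflection_le g (fun K hK hKK => ?_) hH
  have hjK : (j K)ᴴ = j K := by rw [← Matrix.star_eq_conjTranspose, ← map_star,
    Matrix.star_eq_conjTranspose, hK]
  refine (le_abs_self _).trans (abs_commutator_le_of_reflection hρ hP hjK
    fun c s hcs => ?_)
  -- (c + isK)(c - isK) = c² + s²K² = 1.
  have hV : ((c : ℂ) • 1 + (s * Complex.I) • K : Matrix m m ℂ) ∈ Matrix.unitaryGroup m ℂ := by
    rw [Matrix.mem_unitaryGroup_iff]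
    simp only [Matrix.star_eq_conjTranspose, Matrix.conjTranspose_add, Matrix.conjTranspose_smul,
      hK, Matrix.conjTranspose_one, Matrix.add_mul, Matrix.mul_add, Matrix.smul_mul,
      Matrix.mul_smul, Matrix.one_mul, Matrix.mul_one, hKK, star_mul', RCLike.star_def,
      Complex.conj_ofReal, Complex.conj_I]
    have hI : (Complex.I : ℂ) ^ 2 = -1 := Complex.I_sq
    have hcs' : (c : ℂ) ^ 2 + (s : ℂ) ^ 2 = 1 := by exact_mod_cast hcs
    match_scalars
    · linear_combination hcs' - (s : ℂ) ^ 2 * hI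
    · ring
  have e : j ((c : ℂ) • 1 + (s * Complex.I) • K) = (c : ℂ) • 1 + (s * Complex.I) • j K := by
    rw [map_add, map_smul, map_smul, map_one]
  rw [← e]
  exact hM _ hV

end Commutator

noncomputable section

/-! ### Operators on subsets of the particles -/

section Operators

variable {ι : Type*} [DecidableEq ι] {d : ι → ℕ} {S T A B : Finset ι}

/-- The label that agrees with `w` on `T` and with `x` elsewhere. -/
def glue (w : Conf d T) (x : Conf d S) : Conf d S :=
  fun i => if h : i.1 ∈ T then w ⟨i.1, h⟩ else x i

theorem res_glue (h : T ⊆ S) (w : Conf d T) (x : Conf d S) : res h (glue w x) = w := by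
  ext i
  simp [res, glue]

theorem glue_of_notMem (w : Conf d T) (x : Conf d S) {i : {i // i ∈ S}} (hi : i.1 ∉ T) :
    glue w x i = x i := by
  simp [glue, hi]

theorem glue_res (h : T ⊆ S) {x y : Conf d S} (hxy : ∀ i : {i // i ∈ S}, i.1 ∉ T → x i = y i) :
    glue (res h y) x = y := by
  ext i
  by_cases hi : i.1 ∈ T
  · simp [glue, res, hi]
  · simp [glue, hi, hxy i hi]

theorem extendOp_apply (h : T ⊆ S) (M : Op d T) (x y : Conf d S) :
    extendOp h M x y =
      if ∀ i : {i // i ∈ S}, i.1 ∉ T → x i = y i then M (res h x) (res h y) else 0 := rfl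

theorem extendOp_one (h : T ⊆ S) : extendOp h (1 : Op d T) = 1 := by
  ext x y
  rw [extendOp_apply, Matrix.one_apply, Matrix.one_apply]
  by_cases hxy : x = y
  · simp [hxy]
  · rw [if_neg hxy]
    split_ifs with h1 h2
    · refine absurd ?_ hxy
      rw [← glue_res h h1, ← h2, glue_res h fun _ _ => rfl]
    · rfl
    · rfl

theorem extendOp_mul (h : T ⊆ S) (M N : Op d T) :
    extendOp h (M * N) = extendOp h M * extendOp h N := by
  ext x z
  simp only [extendOp_apply, Matrix.mul_apply]
  split_ifs with hxz
  · refine Finset.sum_of_injOn (fun w => glue w x) ?_ (fun _ _ => by simp) ?_ ?_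
    · intro w _ w' _ hw
      have := congrArg (res h) hw
      simpa only [res_glue] using this
    · intro y _ hy
      rw [if_neg, zero_mul]
      intro hxy
      exact hy ⟨res h y, by simp, glue_res h hxy⟩
    · intro w _
      rw [if_pos, if_pos, res_glue]
      · intro i hi
        rw [glue_of_notMem _ _ hi, hxz i hi]
      · intro i hi
        rw [glue_of_notMem _ _ hi]
  · refine (Finset.sum_eq_zero fun y _ => ?_).symm
    split_ifs with h1 h2
    · exact absurd (fun i hi => (h1 i hi).trans (h2 i hi)) hxz
    all_goals simp

theorem extendOp_conjTranspose (h : T ⊆ S) (M : Op d T) : extendOp h Mᴴ = (extendOp h M)ᴴ := by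
  ext x y
  simp only [extendOp_apply, Matrix.conjTranspose_apply, eq_comm (a := x _)]
  split_ifs <;> simp

/-- `M ↦ M ⊗ 1` as a homomorphism of star algebras. -/
def extendHom (h : T ⊆ S) : Op d T →⋆ₐ[ℂ] Op d S where
  toFun := extendOp h
  map_one' := extendOp_one h
  map_mul' := extendOp_mul h
  map_zero' := by ext x y; simp [extendOp_apply]
  map_add' M N := by
    ext x y
    simp only [extendOp_apply, Matrix.add_apply]
    split_ifs <;> simp
  commutes' r := by
    rw [Algebra.algebraMap_eq_smul_one, Algebra.algebraMap_eq_smul_one, ← extendOp_one h]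
    ext x y
    simp only [extendOp_apply, Matrix.smul_apply]
    split_ifs <;> simp
  map_star' M := extendOp_conjTranspose h M

@[simp]
theorem extendHom_apply (h : T ⊆ S) (M : Op d T) : extendHom h M = extendOp h M := rfl

theorem extendOp_mem_unitaryGroup (h : T ⊆ S) {U : Op d T}
    (hU : U ∈ Matrix.unitaryGroup (Conf d T) ℂ) :
    extendOp h U ∈ Matrix.unitaryGroup (Conf d S) ℂ :=
  Unitary.map_mem (extendHom h) hU

theorem extendOp_extendOp (hTS : T ⊆ S) (hAT : A ⊆ T) (M : Op d A) :
    extendOp hTS (extendOp hAT M) = extendOp (hAT.trans hTS) M := by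
  ext x y
  simp only [extendOp_apply]
  rw [← ite_and]
  refine if_congr ⟨?_, ?_⟩ rfl rfl
  · rintro ⟨h1, h2⟩ i hi
    by_cases hT : i.1 ∈ T
    · exact h2 ⟨i.1, hT⟩ hi
    · exact h1 i hT
  · exact fun h => ⟨fun i hi => h i fun hA => hi (hAT hA), fun i hi => h ⟨i.1, hTS i.2⟩ hi⟩

/-- Only one intermediate label survives in the product: the one equal to `z` on `A` and to `x`
elsewhere. -/
theorem extendOp_mul_extendOp_apply (hA : A ⊆ S) (hB : B ⊆ S) (hAB : Disjoint A B) (U : Op d A)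
    (V : Op d B) (x z : Conf d S) :
    (extendOp hA U * extendOp hB V) x z =
      if ∀ i : {i // i ∈ S}, i.1 ∉ A → i.1 ∉ B → x i = z i then
        U (res hA x) (res hA z) * V (res hB x) (res hB z) else 0 := by
  rw [Matrix.mul_apply, Finset.sum_eq_single (glue (res hA z) x)]
  · have hB' : res hB (glue (res hA z) x) = res hB x := by
      ext i
      simp [res, glue, Finset.disjoint_right.1 hAB i.2]
    rw [extendOp_apply, extendOp_apply, res_glue, hB',
      if_pos fun i hi => (glue_of_notMem _ _ hi).symm, mul_ite, mul_zero]
    refine if_congr ⟨fun h i hiA hiB => ?_, fun h i hiB => ?_⟩ rfl rfl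
    · rw [← h i hiB, glue_of_notMem _ _ hiA]
    · by_cases hiA : i.1 ∈ A
      · simp [glue, hiA, res]
      · rw [glue_of_notMem _ _ hiA, h i hiA hiB]
  · intro y _ hy
    rw [extendOp_apply, extendOp_apply]
    split_ifs with h1 h2
    · refine absurd ?_ hy
      rw [← glue_res hA h1]
      congr 1
      ext i
      exact congrArg _ (h2 ⟨i.1, hA i.2⟩ (Finset.disjoint_left.1 hAB i.2))
    all_goals simp
  · simp

theorem extendOp_commute (hA : A ⊆ S) (hB : B ⊆ S) (hAB : Disjoint A B) (U : Op d A)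
    (V : Op d B) : extendOp hA U * extendOp hB V = extendOp hB V * extendOp hA U := by
  ext x z
  rw [extendOp_mul_extendOp_apply hA hB hAB, extendOp_mul_extendOp_apply hB hA hAB.symm, mul_comm]
  exact if_congr ⟨fun h i h1 h2 => h i h2 h1, fun h i h1 h2 => h i h2 h1⟩ rfl rfl

theorem tensorOp_eq (hAB : Disjoint A B) (U : Op d A) (V : Op d B) :
    tensorOp U V = extendOp Finset.subset_union_left U * extendOp Finset.subset_union_right V := by
  ext x z
  rw [extendOp_mul_extendOp_apply _ _ hAB, if_pos]
  · rfl
  · intro i h1 h2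
    exact absurd i.2 (Finset.notMem_union.2 ⟨h1, h2⟩)

/-- This duality turns every reduced quantity into a trace over the larger system. -/
theorem trace_partialTrace_mul (h : T ⊆ S) (M : Op d S) (N : Op d T) :
    (partialTrace h M * N).trace = (M * extendOp h N).trace := by
  simp only [Matrix.trace, Matrix.diag_apply, Matrix.mul_apply, partialTrace, Matrix.of_apply,
    extendOp_apply, Finset.sum_mul]
  calc _ = ∑ u : Conf d S, ∑ v : Conf d S, ∑ x : Conf d T, ∑ y : Conf d T,
        (if res h u = x ∧ res h v = y ∧ ∀ i : {i // i ∈ S}, i.1 ∉ T → u i = v i then M u v else 0) *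
          N y x := by
        rw [Finset.sum_congr rfl fun x _ => Finset.sum_comm, Finset.sum_comm]
        refine Finset.sum_congr rfl fun u _ => ?_
        rw [Finset.sum_congr rfl fun x _ => Finset.sum_comm, Finset.sum_comm]
    _ = _ := by
        refine Finset.sum_congr rfl fun u _ => Finset.sum_congr rfl fun v _ => ?_
        rw [Finset.sum_eq_single (res h u), Finset.sum_eq_single (res h v)]
        · simp [eq_comm]
        · intro y _ hy
          rw [if_neg fun h' => hy h'.2.1.symm, zero_mul]
        · simp
        · intro x _ hx
          refine Finset.sum_eq_zero fun y _ => ?_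
          rw [if_neg fun h' => hx h'.1.symm, zero_mul]
        · simp

theorem continuous_extendOp (h : T ⊆ S) : Continuous (extendOp h : Op d T → Op d S) := by
  refine continuous_matrix fun x y => ?_
  simp only [extendOp_apply]
  split_ifs
  · exact continuous_id.matrix_elem _ _
  · exact continuous_const

end Operators

/-- A closed subset of the box of matrices with entries of modulus at most 1. -/
theorem compactSpace_unitaryGroup {n : Type*} [Fintype n] [DecidableEq n] :
    CompactSpace (Matrix.unitaryGroup n ℂ) := by
  apply isCompact_iff_compactSpace.1
  have hbox : IsCompact (Set.pi Set.univ fun _ : n => Set.pi Set.univ fun _ : n =>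
      Metric.closedBall (0 : ℂ) 1) :=
    isCompact_univ_pi fun _ => isCompact_univ_pi fun _ => isCompact_closedBall 0 1
  refine IsCompact.of_isClosed_subset (X := Matrix n n ℂ) hbox ?_ ?_
  · have : (Matrix.unitaryGroup n ℂ : Set (Matrix n n ℂ)) = {U | U * star U = 1} := by
      ext U
      exact Matrix.mem_unitaryGroup_iff
    change IsClosed (Matrix.unitaryGroup n ℂ : Set (Matrix n n ℂ))
    rw [this]
    exact isClosed_eq (continuous_id.matrix_mul continuous_id.matrix_conjTranspose)
      continuous_const
  · intro U hU i _ j _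
    simpa using entry_norm_bound_of_unitary hU i j

/-- Enlarging along a pair that does not cross the boundary changes nothing. -/
theorem enlarge_eq_of_not_crosses {ι : Type*} [DecidableEq ι] {C : Finset ι} {e : Pair ι} (h : ¬ Crosses e C) :
    enlarge C e = C := by
  unfold enlarge
  split_ifs with h1
  · rw [Finset.union_eq_left]
    intro j hj
    by_contra hjC
    exact h ⟨h1, j, hj, hjC⟩
  · rfl

/-! ### The singlet and its fraction -/

section Singlet

variable {ι : Type*} [DecidableEq ι] {d : ι → ℕ} {a b : ι}

theorem star_singlet_dotProduct_singlet (hda : d a = 2) (hdb : d b = 2) (hab : a ≠ b) :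
    star (singlet d a b) ⬝ᵥ singlet d a b = 1 := by
  have hpos : ∀ i : {i // i ∈ ({a, b} : Finset ι)}, d i = 2 := by
    rintro ⟨i, hi⟩
    rcases Finset.mem_insert.1 hi with rfl | hi
    · exact hda
    · obtain rfl := Finset.mem_singleton.1 hi
      exact hdb
  -- `p` and `q` are the labels 01 and 10, the support of the singlet.
  let p : Conf d {a, b} := fun i => ⟨if i.1 = a then 0 else 1, by rw [hpos i]; split_ifs <;> simp⟩
  let q : Conf d {a, b} := fun i => ⟨if i.1 = a then 1 else 0, by rw [hpos i]; split_ifs <;> simp⟩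
  have hpq : p ≠ q := fun h => by
    simpa [p, q] using congrArg Fin.val (congrFun h ⟨a, by simp⟩)
  have hne : ∀ x : Conf d {a, b}, x ∉ ({p, q} : Finset (Conf d {a, b})) → singlet d a b x = 0 := by
    intro x hx
    simp only [Finset.mem_insert, Finset.mem_singleton, not_or] at hx
    unfold singlet
    dsimp only
    split_ifs with h1 h2
    · refine absurd ?_ hx.1
      ext ⟨i, hi⟩
      by_cases hia : i = a
      · subst hia; simp [p, h1.1]
      · obtain rfl : i = b := by simpa [hia] using hi
        simp [p, h1.2, hia]
    · refine absurd ?_ hx.2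
      ext ⟨i, hi⟩
      by_cases hia : i = a
      · subst hia; simp [q, h2.1]
      · obtain rfl : i = b := by simpa [hia] using hi
        simp [q, h2.2, hia]
    · rfl
  have h2 : ((Real.sqrt 2 : ℝ) : ℂ) * ((Real.sqrt 2 : ℝ) : ℂ) = 2 := by
    rw [← Complex.ofReal_mul, Real.mul_self_sqrt (by norm_num)]
    norm_num
  have h2' : ((Real.sqrt 2 : ℝ) : ℂ)⁻¹ * ((Real.sqrt 2 : ℝ) : ℂ)⁻¹ = 1 / 2 := by
    rw [← mul_inv, h2, one_div]
  rw [dotProduct, ← Finset.sum_subset (Finset.subset_univ {p, q}) fun x _ hx => by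
    rw [hne x hx, mul_zero], Finset.sum_pair hpq]
  have e1 : singlet d a b p = ((Real.sqrt 2 : ℝ) : ℂ)⁻¹ := by
    simp [singlet, p, hab.symm]
  have e2 : singlet d a b q = -((Real.sqrt 2 : ℝ) : ℂ)⁻¹ := by
    simp [singlet, q, hab.symm]
  rw [Pi.star_apply, Pi.star_apply, e1, e2]
  simp only [star_neg, RCLike.star_def, map_inv₀, Complex.conj_ofReal, neg_mul_neg, h2']
  norm_num

/-- The projection onto the singlet of `a` and `b`. -/
def singletProj (d : ι → ℕ) (a b : ι) : Op d {a, b} :=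
  Matrix.vecMulVec (singlet d a b) (star (singlet d a b))

theorem singletProj_conjTranspose : (singletProj d a b)ᴴ = singletProj d a b := by
  rw [singletProj, Matrix.conjTranspose_vecMulVec, star_star]

theorem singletProj_mul_self (hda : d a = 2) (hdb : d b = 2) (hab : a ≠ b) :
    singletProj d a b * singletProj d a b = singletProj d a b := by
  rw [singletProj, Matrix.vecMulVec_mul_vecMulVec, star_singlet_dotProduct_singlet hda hdb hab,
    one_smul]

theorem star_dotProduct_mulVec_eq_trace {n : Type*} [Fintype n] (M : Matrix n n ℂ) (φ : n → ℂ) :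
    star φ ⬝ᵥ (M *ᵥ φ) = (M * Matrix.vecMulVec φ (star φ)).trace := by
  rw [Matrix.mul_vecMulVec, Matrix.trace_vecMulVec, dotProduct_comm]

/-! ### The fraction as a maximum over rotated projections -/

variable [Fintype ι] {A B : Finset ι}

/-- The projection onto the singlet, rotated by unitaries on `A` and on `B`. -/
def rotatedProj (a b : ι) (U : Op d A) (V : Op d B) : Op d Finset.univ :=
  (extendOp (Finset.subset_univ A) U * extendOp (Finset.subset_univ B) V)ᴴ *
    extendOp (Finset.subset_univ {a, b}) (singletProj d a b) *
    (extendOp (Finset.subset_univ A) U * extendOp (Finset.subset_univ B) V)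

/-- The expectation of the singlet projection after the rotations `U` and `V`. -/
def rotatedValue (a b : ι) (ρ : Op d Finset.univ) (U : Op d A) (V : Op d B) : ℝ :=
  (ρ * rotatedProj a b U V).trace.re

theorem reducedFraction_eq_iSup (ha : a ∈ A) (hb : b ∈ B) (hAB : Disjoint A B)
    (ρ : Op d Finset.univ) :
    reducedFraction ha hb ρ =
      ⨆ W : Matrix.unitaryGroup (Conf d A) ℂ × Matrix.unitaryGroup (Conf d B) ℂ,
        rotatedValue a b ρ (W.1 : Op d A) (W.2 : Op d B) := by
  unfold reducedFraction singletFraction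
  congr 1
  ext W
  rw [star_dotProduct_mulVec_eq_trace, trace_partialTrace_mul, Matrix.mul_assoc, Matrix.mul_assoc,
    Matrix.trace_mul_comm, Matrix.mul_assoc, trace_partialTrace_mul, tensorOp_eq hAB, extendOp_mul,
    extendOp_mul, extendOp_conjTranspose, extendOp_mul, extendOp_extendOp, extendOp_extendOp,
    extendOp_extendOp]
  rfl

theorem rotatedProj_posSemidef (hda : d a = 2) (hdb : d b = 2) (hab : a ≠ b) (U : Op d A)
    (V : Op d B) : (rotatedProj a b U V).PosSemidef := by
  refine Matrix.PosSemidef.conjTranspose_mul_mul_same ?_ _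
  rw [← singletProj_mul_self hda hdb hab]
  nth_rewrite 1 [← singletProj_conjTranspose]
  rw [extendOp_mul, extendOp_conjTranspose]
  exact Matrix.posSemidef_conjTranspose_mul_self _

/-- Conjugating the singlet projection by any unitary keeps its expectation at most `1`. -/
theorem re_trace_mul_conj_singletProj_le_one (hda : d a = 2) (hdb : d b = 2) (hab : a ≠ b)
    {ρ : Op d Finset.univ} (hρ : IsDensity ρ) {N : Op d Finset.univ}
    (hN : N ∈ Matrix.unitaryGroup (Conf d Finset.univ) ℂ) :
    (ρ * (Nᴴ * extendOp (Finset.subset_univ {a, b}) (singletProj d a b) * N)).trace.re ≤ 1 := by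
  set Q := extendOp (Finset.subset_univ {a, b}) (singletProj d a b) with hQ
  have hQQ : Q * Q = Q := by rw [hQ, ← extendOp_mul, singletProj_mul_self hda hdb hab]
  have hQs : Qᴴ = Q := by rw [hQ, ← extendOp_conjTranspose, singletProj_conjTranspose]
  have h1Q : (1 - Q : Op d Finset.univ).PosSemidef := by
    have e : (1 - Q : Op d Finset.univ) = (1 - Q)ᴴ * (1 - Q) := by
      rw [Matrix.conjTranspose_sub, Matrix.conjTranspose_one, hQs, Matrix.sub_mul, Matrix.mul_sub,
        Matrix.mul_sub, hQQ]
      simp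
    rw [e]
    exact Matrix.posSemidef_conjTranspose_mul_self _
  have h := re_trace_mul_nonneg hρ.1 (h1Q.conjTranspose_mul_mul_same N)
  have hNN : Nᴴ * N = 1 := Matrix.mem_unitaryGroup_iff'.1 hN
  rw [Matrix.mul_sub, Matrix.mul_one, Matrix.sub_mul, hNN, Matrix.mul_sub, Matrix.trace_sub,
    Matrix.mul_one, hρ.2, Complex.sub_re, Complex.one_re] at h
  linarith

theorem rotation_mem_unitaryGroup {U : Op d A} {V : Op d B}
    (hU : U ∈ Matrix.unitaryGroup (Conf d A) ℂ) (hV : V ∈ Matrix.unitaryGroup (Conf d B) ℂ) :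
    extendOp (Finset.subset_univ A) U * extendOp (Finset.subset_univ B) V ∈
      Matrix.unitaryGroup (Conf d Finset.univ) ℂ :=
  mul_mem (extendOp_mem_unitaryGroup _ hU) (extendOp_mem_unitaryGroup _ hV)

theorem rotatedValue_le_one (hda : d a = 2) (hdb : d b = 2) (hab : a ≠ b) {ρ : Op d Finset.univ}
    (hρ : IsDensity ρ) {U : Op d A} {V : Op d B} (hU : U ∈ Matrix.unitaryGroup (Conf d A) ℂ)
    (hV : V ∈ Matrix.unitaryGroup (Conf d B) ℂ) : rotatedValue a b ρ U V ≤ 1 :=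
  re_trace_mul_conj_singletProj_le_one hda hdb hab hρ (rotation_mem_unitaryGroup hU hV)

theorem rotatedValue_le_reducedFraction (hda : d a = 2) (hdb : d b = 2) (ha : a ∈ A) (hb : b ∈ B)
    (hAB : Disjoint A B) {ρ : Op d Finset.univ} (hρ : IsDensity ρ) {U : Op d A} {V : Op d B}
    (hU : U ∈ Matrix.unitaryGroup (Conf d A) ℂ) (hV : V ∈ Matrix.unitaryGroup (Conf d B) ℂ) :
    rotatedValue a b ρ U V ≤ reducedFraction ha hb ρ := by
  rw [reducedFraction_eq_iSup ha hb hAB]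
  refine le_ciSup (f := fun W : Matrix.unitaryGroup (Conf d A) ℂ × Matrix.unitaryGroup (Conf d B) ℂ
    => rotatedValue a b ρ (W.1 : Op d A) (W.2 : Op d B)) ⟨1, ?_⟩ (⟨U, hU⟩, ⟨V, hV⟩)
  rintro _ ⟨W, rfl⟩
  exact rotatedValue_le_one hda hdb (hAB.forall_ne_finset ha hb) hρ W.1.2 W.2.2

theorem reducedFraction_le_one (hda : d a = 2) (hdb : d b = 2) (ha : a ∈ A) (hb : b ∈ B)
    (hAB : Disjoint A B) {ρ : Op d Finset.univ} (hρ : IsDensity ρ) :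
    reducedFraction ha hb ρ ≤ 1 := by
  rw [reducedFraction_eq_iSup ha hb hAB]
  exact ciSup_le fun W => rotatedValue_le_one hda hdb (hAB.forall_ne_finset ha hb) hρ W.1.2 W.2.2

/-! ### Enlarged sets and absorption of unitaries -/

variable {A' B' e : Finset ι}

theorem rotatedProj_extendOp (hA : A ⊆ A') (hB : B ⊆ B') (U : Op d A) (V : Op d B) :
    rotatedProj a b (extendOp hA U) (extendOp hB V) = rotatedProj a b U V := by
  simp only [rotatedProj, extendOp_extendOp]

theorem reducedFraction_mono (hda : d a = 2) (hdb : d b = 2) (ha : a ∈ A) (hb : b ∈ B)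
    (hA : A ⊆ A') (hB : B ⊆ B') (hAB : Disjoint A' B') {ρ : Op d Finset.univ} (hρ : IsDensity ρ) :
    reducedFraction ha hb ρ ≤ reducedFraction (hA ha) (hB hb) ρ := by
  rw [reducedFraction_eq_iSup ha hb (hAB.mono hA hB)]
  refine ciSup_le fun W => ?_
  rw [rotatedValue, ← rotatedProj_extendOp hA hB]
  exact rotatedValue_le_reducedFraction hda hdb _ _ hAB hρ (extendOp_mem_unitaryGroup hA W.1.2)
    (extendOp_mem_unitaryGroup hB W.2.2)

/-- A unitary on `e ⊆ A'` can be absorbed into the rotation of `A'`. -/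
theorem rotatedProj_conj_left (hA : A ⊆ A') (hB : B ⊆ B') (he : e ⊆ A') (hAB : Disjoint A' B')
    (U : Op d A) (V : Op d B) (N : Op d e) :
    (extendOp (Finset.subset_univ e) N)ᴴ * rotatedProj a b U V * extendOp (Finset.subset_univ e) N =
      rotatedProj a b (extendOp hA U * extendOp he N) (extendOp hB V) := by
  have h : extendOp (Finset.subset_univ A) U * extendOp (Finset.subset_univ B) V *
      extendOp (Finset.subset_univ e) N =
      extendOp (Finset.subset_univ A') (extendOp hA U * extendOp he N) *
        extendOp (Finset.subset_univ B') (extendOp hB V) := by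
    rw [extendOp_mul, extendOp_extendOp, extendOp_extendOp, extendOp_extendOp, mul_assoc,
      extendOp_commute _ _ (hAB.mono he hB).symm, mul_assoc]
  rw [rotatedProj, rotatedProj, ← h, Matrix.conjTranspose_mul _ (extendOp _ N)]
  simp only [Matrix.mul_assoc]

/-- A unitary on `e ⊆ B'` can be absorbed into the rotation of `B'`. -/
theorem rotatedProj_conj_right (hA : A ⊆ A') (hB : B ⊆ B') (he : e ⊆ B') (U : Op d A) (V : Op d B)
    (N : Op d e) :
    (extendOp (Finset.subset_univ e) N)ᴴ * rotatedProj a b U V * extendOp (Finset.subset_univ e) N =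
      rotatedProj a b (extendOp hA U) (extendOp hB V * extendOp he N) := by
  have h : extendOp (Finset.subset_univ A) U * extendOp (Finset.subset_univ B) V *
      extendOp (Finset.subset_univ e) N =
      extendOp (Finset.subset_univ A') (extendOp hA U) *
        extendOp (Finset.subset_univ B') (extendOp hB V * extendOp he N) := by
    rw [extendOp_mul, extendOp_extendOp, extendOp_extendOp, extendOp_extendOp, mul_assoc]
  rw [rotatedProj, rotatedProj, ← h, Matrix.conjTranspose_mul _ (extendOp _ N)]
  simp only [Matrix.mul_assoc]

/-- A unitary on a set that meets neither `A` nor `B` does not change the rotated projection. -/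
theorem rotatedProj_conj_of_disjoint (ha : a ∈ A) (hb : b ∈ B) (heA : Disjoint e A)
    (heB : Disjoint e B) (U : Op d A) (V : Op d B) {N : Op d e}
    (hN : N ∈ Matrix.unitaryGroup (Conf d e) ℂ) :
    (extendOp (Finset.subset_univ e) N)ᴴ * rotatedProj a b U V * extendOp (Finset.subset_univ e) N =
      rotatedProj a b U V := by
  have heab : Disjoint e {a, b} := by
    rw [Finset.disjoint_insert_right, Finset.disjoint_singleton_right]
    exact ⟨Finset.disjoint_right.1 heA ha, Finset.disjoint_right.1 heB hb⟩
  have hNN : (extendOp (Finset.subset_univ e) N)ᴴ * extendOp (Finset.subset_univ e) N = 1 :=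
    Matrix.mem_unitaryGroup_iff'.1 (extendOp_mem_unitaryGroup _ hN)
  have hcomm : rotatedProj a b U V * extendOp (Finset.subset_univ e) N =
      extendOp (Finset.subset_univ e) N * rotatedProj a b U V := by
    have hA : ∀ X, Commute (extendOp _ N) (extendOp _ X) :=
      extendOp_commute (Finset.subset_univ e) (Finset.subset_univ A) heA N
    have hB : ∀ X, Commute (extendOp _ N) (extendOp _ X) :=
      extendOp_commute (Finset.subset_univ e) (Finset.subset_univ B) heB N
    have hQ : ∀ X, Commute (extendOp _ N) (extendOp _ X) :=
      extendOp_commute (Finset.subset_univ e) (Finset.subset_univ {a, b}) heab N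
    simp only [rotatedProj, Matrix.conjTranspose_mul, ← extendOp_conjTranspose]
    exact ((((hB _).mul_right (hA _)).mul_right (hQ _)).mul_right ((hA _).mul_right (hB _))).symm.eq
  rw [Matrix.mul_assoc, hcomm, ← Matrix.mul_assoc, hNN, Matrix.one_mul]

theorem continuous_rotatedProj (a b : ι) :
    Continuous fun W : Matrix.unitaryGroup (Conf d A) ℂ × Matrix.unitaryGroup (Conf d B) ℂ =>
      rotatedProj a b (W.1 : Op d A) (W.2 : Op d B) := by
  have h : Continuous fun W : Matrix.unitaryGroup (Conf d A) ℂ × Matrix.unitaryGroup (Conf d B) ℂ =>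
      extendOp (Finset.subset_univ A) (W.1 : Op d A) *
        extendOp (Finset.subset_univ B) (W.2 : Op d B) :=
    ((continuous_extendOp _).comp (continuous_subtype_val.comp continuous_fst)).matrix_mul
      ((continuous_extendOp _).comp (continuous_subtype_val.comp continuous_snd))
  exact (h.matrix_conjTranspose.matrix_mul continuous_const).matrix_mul h

/-- The rate of change of a maximal rotated singlet fraction due to the interaction `K` of the
pair `e`. -/
theorem rotated_commutator_le (hda : d a = 2) (hdb : d b = 2) (ha : a ∈ A) (hb : b ∈ B)
    (hAB : Disjoint A B) {ρ : Op d Finset.univ} (hρ : IsDensity ρ) {U : Op d A} {V : Op d B}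
    (hU : U ∈ Matrix.unitaryGroup (Conf d A) ℂ) (hV : V ∈ Matrix.unitaryGroup (Conf d B) ℂ)
    (hmax : rotatedValue a b ρ U V = reducedFraction ha hb ρ) (e : Pair ι) {K : Op d e.1}
    (hK : K.IsHermitian) :
    ((-Complex.I • (extendOp (Finset.subset_univ e.1) K * ρ -
        ρ * extendOp (Finset.subset_univ e.1) K)) * rotatedProj a b U V).trace.re ≤
      hsNorm K * (2 * (Real.sqrt (reducedFraction ha hb ρ) *
        Real.sqrt (pathFraction ha hb e ρ - reducedFraction ha hb ρ))) := by
  have hab : a ≠ b := hAB.forall_ne_finset ha hb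
  rw [← hmax]
  refine commutator_le (extendHom (Finset.subset_univ e.1)) hρ.1
    (rotatedProj_posSemidef hda hdb hab U V) (fun N hN => ?_) hK
  rw [extendHom_apply, pathFraction]
  have heA : ∀ {C : Finset ι}, (∃ i ∈ e.1, i ∈ C) → e.1 ⊆ enlarge C e := fun h => by
    rw [enlarge, if_pos h]; exact Finset.subset_union_right
  split_ifs with hd
  · by_cases h1 : ∃ i ∈ e.1, i ∈ A
    · rw [rotatedProj_conj_left (subset_enlarge A e) (subset_enlarge B e) (heA h1) hd]
      exact rotatedValue_le_reducedFraction hda hdb _ _ hd hρ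
        (mul_mem (extendOp_mem_unitaryGroup _ hU) (extendOp_mem_unitaryGroup _ hN))
        (extendOp_mem_unitaryGroup _ hV)
    by_cases h2 : ∃ i ∈ e.1, i ∈ B
    · rw [rotatedProj_conj_right (subset_enlarge A e) (subset_enlarge B e) (heA h2)]
      exact rotatedValue_le_reducedFraction hda hdb _ _ hd hρ (extendOp_mem_unitaryGroup _ hU)
        (mul_mem (extendOp_mem_unitaryGroup _ hV) (extendOp_mem_unitaryGroup _ hN))
    · push Not at h1 h2
      rw [rotatedProj_conj_of_disjoint ha hb (Finset.disjoint_left.2 h1) (Finset.disjoint_left.2 h2)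
        U V hN]
      exact hmax.le.trans (reducedFraction_mono hda hdb ha hb _ _ hd hρ)
  -- When the enlarged sets overlap, the combined unitary need not be local, and only the bound
  -- valid for every global unitary remains.
  · have hmem := mul_mem (rotation_mem_unitaryGroup hU hV)
      (extendOp_mem_unitaryGroup (Finset.subset_univ e.1) hN)
    have := re_trace_mul_conj_singletProj_le_one hda hdb hab hρ hmem
    rw [Matrix.conjTranspose_mul _ (extendOp _ N)] at this
    simpa only [rotatedProj, Matrix.mul_assoc] using this

/-! ### Comparison of path fractions, and the derivative bound -/

theorem reducedFraction_congr {A₁ A₂ B₁ B₂ : Finset ι} (hA : A₁ = A₂) (hB : B₁ = B₂)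
    (ha : a ∈ A₁) (hb : b ∈ B₁) (ρ : Op d Finset.univ) :
    reducedFraction ha hb ρ = reducedFraction (hA ▸ ha) (hB ▸ hb) ρ := by
  subst hA hB
  rfl

theorem pathFraction_of_notMem_boundary (ha : a ∈ A) (hb : b ∈ B) (hAB : Disjoint A B)
    {e : Pair ι} (he : e ∉ boundary A B) (ρ : Op d Finset.univ) :
    pathFraction ha hb e ρ = reducedFraction ha hb ρ := by
  simp only [boundary, Finset.mem_filter, Finset.mem_univ, true_and, not_or] at he
  have hA := enlarge_eq_of_not_crosses he.1
  have hB := enlarge_eq_of_not_crosses he.2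
  rw [pathFraction, if_pos (by rwa [hA, hB])]
  exact reducedFraction_congr hA hB _ _ ρ

theorem pathFraction_le_one (hda : d a = 2) (hdb : d b = 2) (ha : a ∈ A) (hb : b ∈ B)
    {ρ : Op d Finset.univ} (hρ : IsDensity ρ) (e : Pair ι) : pathFraction ha hb e ρ ≤ 1 := by
  unfold pathFraction
  split_ifs with hd
  · exact reducedFraction_le_one hda hdb _ _ hd hρ
  · exact le_rfl

theorem enlarge_subset_nbhd (H : Network d) (C : Finset ι) {e : Pair ι} (he : H.term e ≠ 0) :
    enlarge C e ⊆ H.nbhd C := by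
  unfold enlarge
  split_ifs with h
  · refine Finset.union_subset (H.subset_nbhd C) fun i hi => ?_
    obtain ⟨j, hje, hjC⟩ := h
    simp only [Network.nbhd, Finset.mem_filter, Finset.mem_univ, true_and]
    exact Or.inr ⟨e, he, hi, j, hjC, hje⟩
  · exact H.subset_nbhd C

theorem pathFraction_le_nbhd (hda : d a = 2) (hdb : d b = 2) (ha : a ∈ A) (hb : b ∈ B)
    (H : Network d) (hd : Disjoint (H.nbhd A) (H.nbhd B)) {ρ : Op d Finset.univ} (hρ : IsDensity ρ)
    {e : Pair ι} (he : H.term e ≠ 0) :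
    pathFraction ha hb e ρ ≤
      reducedFraction (H.subset_nbhd A ha) (H.subset_nbhd B hb) ρ := by
  have hA := enlarge_subset_nbhd H A he
  have hB := enlarge_subset_nbhd H B he
  rw [pathFraction, if_pos (hd.mono hA hB)]
  exact reducedFraction_mono hda hdb _ _ hA hB hd hρ

/-- The functional `x ↦ Re tr (x P)`. -/
def traceFunctional {n : Type*} [Fintype n] (P : Matrix n n ℂ) : (n → n → ℂ) →L[ℝ] ℝ :=
  LinearMap.toContinuousLinearMap
    { toFun := fun x => (Matrix.of x * P).trace.re
      map_add' := fun x y => by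
        rw [← Complex.add_re, ← Matrix.trace_add, ← Matrix.add_mul]
        rfl
      map_smul' := fun r x => by
        rw [RingHom.id_apply, smul_eq_mul, ← Complex.re_ofReal_mul, ← smul_eq_mul (r : ℂ),
          ← Matrix.trace_smul, ← Matrix.smul_mul]
        rfl }

theorem continuous_traceFunctional {n : Type*} [Fintype n] :
    Continuous (traceFunctional : Matrix n n ℂ → _) :=
  continuous_clm_apply.2 fun _ => Complex.continuous_re.comp
    (continuous_const.matrix_mul continuous_id).matrix_trace

/-- The one-sided derivatives exist, and the right one is at most the sum of the contributions of
all pairs. -/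
theorem exists_oneSided_deriv_reducedFraction {H : ℝ → Network d} {ρ : ℝ → Op d Finset.univ}
    (hρ : IsEvolution H ρ) (hda : d a = 2) (hdb : d b = 2) (ha : a ∈ A) (hb : b ∈ B)
    (hAB : Disjoint A B) (t : ℝ) :
    ∃ l r : ℝ,
      HasDerivWithinAt (fun s => reducedFraction ha hb (ρ s)) l (Set.Iic t) t ∧
      HasDerivWithinAt (fun s => reducedFraction ha hb (ρ s)) r (Set.Ici t) t ∧
      l ≤ r ∧
      r ≤ 2 * ∑ e ∈ boundary A B, hsNorm ((H t).term e) *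
        Real.sqrt (reducedFraction ha hb (ρ t)) *
          Real.sqrt (pathFraction ha hb e (ρ t) - reducedFraction ha hb (ρ t)) := by
  have := compactSpace_unitaryGroup (n := Conf d A)
  have := compactSpace_unitaryGroup (n := Conf d B)
  have hF : ∀ s, reducedFraction ha hb (ρ s) =
      ⨆ W : Matrix.unitaryGroup (Conf d A) ℂ × Matrix.unitaryGroup (Conf d B) ℂ,
        traceFunctional (rotatedProj a b (W.1 : Op d A) (W.2 : Op d B)) (ρ s) := fun s =>
    reducedFraction_eq_iSup ha hb hAB (ρ s)
  have hder : HasDerivAt (fun s => (ρ s : Conf d Finset.univ → Conf d Finset.univ → ℂ))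
      (-Complex.I • ((H t).hamiltonian * ρ t - ρ t * (H t).hamiltonian)) t :=
    hasDerivAt_pi.2 fun x => hasDerivAt_pi.2 fun y => hρ.vonNeumann t x y
  obtain ⟨l, r, hl, hr, hlr, W, hW, hrW⟩ := exists_oneSided_deriv_iSup_clm
    (continuous_traceFunctional.comp (continuous_rotatedProj (A := A) (B := B) a b)) hder
  simp only [Function.comp_apply] at hl hr hW hrW
  simp only [← hF] at hl hr
  refine ⟨l, r, hl, hr, hlr, hrW.trans ?_⟩
  have hmax : rotatedValue a b (ρ t) (W.1 : Op d A) (W.2 : Op d B) = reducedFraction ha hb (ρ t) := by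
    rw [hF]
    exact (iSup_eq_of_forall_le hW).symm
  have hexp : traceFunctional (rotatedProj a b (W.1 : Op d A) (W.2 : Op d B))
      (-Complex.I • ((H t).hamiltonian * ρ t - ρ t * (H t).hamiltonian)) =
      ∑ e : Pair ι, ((-Complex.I • (extendOp (Finset.subset_univ e.1) ((H t).term e) * ρ t -
        ρ t * extendOp (Finset.subset_univ e.1) ((H t).term e))) *
          rotatedProj a b (W.1 : Op d A) (W.2 : Op d B)).trace.re := by
    rw [← Complex.re_sum, ← Matrix.trace_sum, ← Matrix.sum_mul, ← Finset.smul_sum,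
      Finset.sum_sub_distrib, ← Matrix.sum_mul, ← Matrix.mul_sum]
    rfl
  rw [hexp, Finset.mul_sum]
  have hle := Finset.sum_le_sum fun (e : Pair ι) (_ : e ∈ Finset.univ) =>
    rotated_commutator_le hda hdb ha hb hAB (hρ.isDensity t) W.1.2 W.2.2 hmax e ((H t).isHermitian e)
  refine hle.trans (le_of_eq ?_)
  -- Off the boundary the path fraction equals the fraction itself, so the second square root
  -- vanishes.
  rw [← Finset.sum_subset (Finset.subset_univ (boundary A B)) fun e _ he => by
    rw [pathFraction_of_notMem_boundary ha hb hAB he, sub_self, Real.sqrt_zero, mul_zero, mul_zero,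
      mul_zero]]
  exact Finset.sum_congr rfl fun e _ => by ring

/-- If all the interacting pairs have path fraction at most `M`, the sum over pathways is bounded by
the total interaction strength. -/
theorem sum_pathFraction_le (H : Network d) (ha : a ∈ A) (hb : b ∈ B) (ρ : Op d Finset.univ) {M : ℝ}
    (hM : ∀ e, H.term e ≠ 0 → pathFraction ha hb e ρ ≤ M) :
    2 * ∑ e ∈ boundary A B, hsNorm (H.term e) * Real.sqrt (reducedFraction ha hb ρ) *
        Real.sqrt (pathFraction ha hb e ρ - reducedFraction ha hb ρ) ≤
      2 * H.boundaryNorm A B * Real.sqrt (reducedFraction ha hb ρ) *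
        Real.sqrt (M - reducedFraction ha hb ρ) := by
  rw [Network.boundaryNorm, mul_assoc, mul_assoc, Finset.sum_mul]
  refine mul_le_mul_of_nonneg_left (Finset.sum_le_sum fun e _ => ?_) zero_le_two
  rw [← mul_assoc]
  -- A vanishing interaction may have path fraction above `M`, since it does not enter the
  -- neighbourhoods, but its norm is zero.
  by_cases he : H.term e = 0
  · have h0 : hsNorm (H.term e) = 0 := by simp [he, hsNorm]
    simp [h0]
  · exact mul_le_mul_of_nonneg_left (Real.sqrt_le_sqrt (sub_le_sub_right (hM e he) _))
      (mul_nonneg (Real.sqrt_nonneg _) (Real.sqrt_nonneg _))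

end Singlet

end

theorem mainTheorem1 {ι : Type*} [Fintype ι] [DecidableEq ι] (d : ι → ℕ)
    (H : ℝ → Network d) (ρ : ℝ → Op d Finset.univ) (hρ : IsEvolution H ρ)
    (a b : ι) (hda : d a = 2) (hdb : d b = 2)
    (A B : Finset ι) (ha : a ∈ A) (hb : b ∈ B) (hAB : Disjoint A B) (t : ℝ) :
    ∃ l r : ℝ,
      HasDerivWithinAt (fun s => reducedFraction ha hb (ρ s)) l (Set.Iic t) t ∧
      HasDerivWithinAt (fun s => reducedFraction ha hb (ρ s)) r (Set.Ici t) t ∧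
      l ≤ r ∧
      (Disjoint ((H t).nbhd A) ((H t).nbhd B) →
        r ≤ 2 * (H t).boundaryNorm A B * Real.sqrt (reducedFraction ha hb (ρ t)) *
          Real.sqrt (reducedFraction ((H t).subset_nbhd A ha) ((H t).subset_nbhd B hb) (ρ t) -
            reducedFraction ha hb (ρ t))) ∧
      (¬ Disjoint ((H t).nbhd A) ((H t).nbhd B) →
        r ≤ 2 * (H t).boundaryNorm A B * Real.sqrt (reducedFraction ha hb (ρ t)) *
          Real.sqrt (1 - reducedFraction ha hb (ρ t))) ∧
      r ≤ 2 * ∑ e ∈ boundary A B, hsNorm ((H t).term e) *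
        Real.sqrt (reducedFraction ha hb (ρ t)) *
          Real.sqrt (pathFraction ha hb e (ρ t) - reducedFraction ha hb (ρ t)) := by
  obtain ⟨l, r, hl, hr, hlr, hbound⟩ :=
    exists_oneSided_deriv_reducedFraction hρ hda hdb ha hb hAB t
  exact ⟨l, r, hl, hr, hlr,
    fun hd => hbound.trans (sum_pathFraction_le (H t) ha hb (ρ t) fun _ he =>
      pathFraction_le_nbhd hda hdb ha hb (H t) hd (hρ.isDensity t) he),
    fun _ => hbound.trans (sum_pathFraction_le (H t) ha hb (ρ t) fun e _ =>
      pathFraction_le_one hda hdb ha hb (hρ.isDensity t) e),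
    hbound⟩
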